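/- Let $M$ be a closed (compact, without boundary), connected, oriented smooth 3-manifold with a nowhere-vanishing smooth vector field $V$. A $V$-transverse curve is a smooth map $C\colon S^1\to M$ such that $C'(t)$ and $V_{C(t)}$ are linearly independent for all $t$; the space of $V$-transverse curves carries the $C^\infty$-topology, and its path components are called $V$-transverse homotopy classes. A $V$-transverse (two-component, ordered) multi-curve is a pair $(K_1,K_2)$ of $V$-transverse curves; it is a $V$-transverse link $K_1\sqcup K_2$ if it is an embedding of $S^1\sqcup S^1$. A $V$-transverse homotopy $H=H_1\sqcup H_2$ from $L$ to $L'$ is a path $(H_t)_{t\in[0,1]}$ in the space of $V$-transverse multi-curves from $L$ to $L'$, and a self-homotopy if $L=L'$. It is generic if $H_t$ fails to be an embedding at only finitely many times $t_1,\dots,t_k$, and $H_{t_i}$ has at each of these times a single double point $p_i$, at which the tangent vectors of the two branches are linearly independent. All homotopies of links below are generic. A $V$-transverse link-homotopy is a generic $V$-transverse homotopy of links during which no double point between distinct components occurs, and two links are $V$-transversely link-homotopic if there is a $V$-transverse link-homotopy between them. A $V$-transverse figure-8 $A\bullet_p B$ is a pair of $V$-transverse curves $A,B$ with a distinguished common point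 $p$, regarded as a map $S^1\vee S^1\to M$; let $[A\bullet_p B]$ denote its homotopy class through $V$-transverse figure-8's. For a generic $V$-transverse homotopy $H$ from $L=K_1\sqcup K_2$ to $L'$, let $D_{12}$ be the set of those double points $p_i$ that lie on both components, and put $$\nu(H)=\sum_{p_i\in D_{12}}\epsilon(t_i)\,[H_{t_i}(K_1)\bullet_{p_i}H_{t_i}(K_2)],$$ an element of the free abelian group on the homotopy classes of $V$-transverse figure-8's. Here $\epsilon(t_i)=+1$ if at $t_i$ the homotopy passes from a negative to a positive crossing of the two components near $p_i$, $\epsilon(t_i)=-1$ if it passes from a positive to a negative crossing (and $\epsilon(t_i)=0$ if the strands only touch, so that the crossing is the same before and after $t_i$). **Proposition.** Let $\mathcal C_{V,1}$ and $\mathcal C_{V,2}$ be $V$-transverse homotopy classes. Suppose that $\nu(H_1\sqcup H_2)=0$ for every generic $V$-transverse self-homotopy $H_1\sqcup H_2$ of every $V$-transverse link $K_1\sqcup K_2$ with $K_1\in\mathcal C_{V,1}$ and $K_2\in\mathcal C_{V,2}$. Then, for any two $V$-transverse links $L=K_1\sqcup K_2$ and $L'=K_1'\sqcup K_2'$ that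 have components in $\mathcal C_{V,1}$ and $\mathcal C_{V,2}$ (respectively) and are $V$-transversely link-homotopic, $\nu(H_1'\sqcup H_2')=0$ for every generic $V$-transverse homotopy $H_1'\sqcup H_2'$ from $L$ to $L'$. -/

import Mathlib

open Set Filter Topology Manifold
open scoped ContDiff unitInterval

noncomputable section

/-- The model space of a 3-manifold. -/
abbrev E3 : Type := EuclideanSpace ℝ (Fin 3)

section Loops

variable {M : Type*} [TopologicalSpace M] [ChartedSpace E3 M]

/-- An orientation of a smooth 3-manifold: an orientation of every tangent space which is
locally constant when read in the local trivializations of the tangent bundle (that is, in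
the differentials of the charts). -/
structure ManifoldOrientation (M : Type*) [TopologicalSpace M] [ChartedSpace E3 M]
    [IsManifold (𝓡 3) ∞ M] where
  /-- The orientation of the tangent space at `p`. -/
  orientationAt : ∀ p : M, Orientation ℝ (TangentSpace (𝓡 3) p) (Fin 3)
  locally_constant : ∀ p : M, ∀ᶠ q in 𝓝 p,
    ∀ hq : q ∈ (trivializationAt E3 (TangentSpace (𝓡 3) : M → Type _) p).baseSet,
      Orientation.map (Fin 3)
          ((trivializationAt E3 (TangentSpace (𝓡 3) : M → Type _) p).linearEquivAt ℝ q hq)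
          (orientationAt q) =
        Orientation.map (Fin 3)
          ((trivializationAt E3 (TangentSpace (𝓡 3) : M → Type _) p).linearEquivAt ℝ p
            (FiberBundle.mem_baseSet_trivializationAt' p))
          (orientationAt p)

/-- The orientation at `p`, read in the coordinates of the preferred chart at `p`. -/
def ManifoldOrientation.inChart [IsManifold (𝓡 3) ∞ M] (o : ManifoldOrientation M) (p : M) :
    Orientation ℝ E3 (Fin 3) :=
  Orientation.map (Fin 3)
    ((trivializationAt E3 (TangentSpace (𝓡 3) : M → Type _) p).linearEquivAt ℝ p
      (FiberBundle.mem_baseSet_trivializationAt' p))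
    (o.orientationAt p)

/-- A smooth map `S¹ = ℝ/ℤ → M`, written as a smooth map on `ℝ` of period `1`. -/
structure SmoothLoop (M : Type*) [TopologicalSpace M] [ChartedSpace E3 M] where
  toFun : ℝ → M
  periodic' : Function.Periodic toFun 1
  smooth' : ContMDiff 𝓘(ℝ, ℝ) (𝓡 3) ∞ toFun

instance : CoeFun (SmoothLoop M) (fun _ => ℝ → M) := ⟨SmoothLoop.toFun⟩

/-- The basic `C^∞`-neighbourhoods of a loop `γ`: for a chart `e`, a compact set `K` of
parameters which `γ` maps into the domain of `e`, an order `k` and `ε > 0`, the loops `δ` which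
map `K` into the domain of `e` and whose derivatives of order `≤ k` in the chart are
`ε`-close to those of `γ` on `K`. -/
def SmoothLoop.basicNhd (γ : SmoothLoop M) (e : OpenPartialHomeomorph M E3) (K : Set ℝ) (k : ℕ)
    (ε : ℝ) : Set (SmoothLoop M) :=
  {δ | MapsTo δ K e.source ∧ ∀ j ≤ k, ∀ t ∈ K,
    ‖iteratedDeriv j (fun s => e (δ s)) t - iteratedDeriv j (fun s => e (γ s)) t‖ < ε}

/-- The `C^∞`-topology on the space of smooth loops. -/
instance SmoothLoop.instTopologicalSpace : TopologicalSpace (SmoothLoop M) :=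
  TopologicalSpace.generateFrom
    {N | ∃ (γ : SmoothLoop M) (e : OpenPartialHomeomorph M E3) (K : Set ℝ) (k : ℕ) (ε : ℝ),
      e ∈ atlas E3 M ∧ IsCompact K ∧ MapsTo γ K e.source ∧ 0 < ε ∧ N = γ.basicNhd e K k ε}

/-- The velocity vector `γ'(t)`. -/
def SmoothLoop.velocity (γ : SmoothLoop M) (t : ℝ) : TangentSpace (𝓡 3) (γ t) :=
  mfderiv 𝓘(ℝ, ℝ) (𝓡 3) γ.toFun t (1 : ℝ)

/-- The velocity vector `γ'(t)` in the coordinates of the preferred chart at `p`. -/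
def SmoothLoop.chartVelocity (p : M) (γ : SmoothLoop M) (t : ℝ) : E3 :=
  deriv (fun s => extChartAt (𝓡 3) p (γ s)) t

/-- The loop `s ↦ γ (s + a)`: the same loop with the base point moved to `γ a`. -/
def SmoothLoop.shift (γ : SmoothLoop M) (a : ℝ) : SmoothLoop M where
  toFun s := γ (s + a)
  periodic' s := by
    have h := γ.periodic' (s + a)
    show γ.toFun (s + 1 + a) = γ.toFun (s + a)
    rw [← h]; congr 1; ring
  smooth' := γ.smooth'.comp ((contDiff_id.add contDiff_const).contMDiff)

/-- A loop is `V`-transverse if `γ'(t)` and `V` at `γ(t)` span a plane for all `t`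
(in particular `γ` is then an immersion). -/
def SmoothLoop.IsTransverse (V : ∀ x : M, TangentSpace (𝓡 3) x) (γ : SmoothLoop M) : Prop :=
  ∀ t : ℝ, LinearIndependent ℝ ![γ.velocity t, V (γ t)]

theorem SmoothLoop.velocity_shift (γ : SmoothLoop M) (a t : ℝ) :
    (γ.shift a).velocity t = γ.velocity (t + a) := by
  have h1 : MDifferentiableAt 𝓘(ℝ, ℝ) (𝓡 3) γ.toFun (t + a) :=
    γ.smooth'.mdifferentiable (by simp) (t + a)
  have h2 : HasFDerivAt (fun s : ℝ => s + a) (ContinuousLinearMap.id ℝ ℝ) t :=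
    (hasFDerivAt_id t).add_const a
  have h3 := HasMFDerivAt.comp t h1.hasMFDerivAt h2.hasMFDerivAt
  have h4 := h3.mfderiv
  unfold SmoothLoop.velocity
  show (mfderiv 𝓘(ℝ, ℝ) (𝓡 3) (γ.toFun ∘ fun s : ℝ => s + a) t) (1 : ℝ) = _
  rw [h4]
  rfl

/-- The space of `V`-transverse curves, with the `C^∞`-topology. -/
def VLoop (V : ∀ x : M, TangentSpace (𝓡 3) x) : Type _ :=
  {γ : SmoothLoop M // γ.IsTransverse V}

variable {V : ∀ x : M, TangentSpace (𝓡 3) x}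

instance : TopologicalSpace (VLoop V) :=
  inferInstanceAs (TopologicalSpace {γ : SmoothLoop M // γ.IsTransverse V})

/-- The underlying smooth loop. -/
def VLoop.loop (γ : VLoop V) : SmoothLoop M := γ.1

instance : CoeFun (VLoop V) (fun _ => ℝ → M) := ⟨fun γ => γ.loop⟩

/-- The same `V`-transverse curve with the base point moved to `γ a`. -/
def VLoop.shift (γ : VLoop V) (a : ℝ) : VLoop V :=
  ⟨γ.loop.shift a, fun t => by
    rw [SmoothLoop.velocity_shift]
    exact γ.2 (t + a)⟩

/-- The space of (ordered) 2-component `V`-transverse multi-curves. -/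
abbrev MultiCurve (V : ∀ x : M, TangentSpace (𝓡 3) x) : Type _ := Fin 2 → VLoop V

/-- The points of `S¹ ⊔ S¹`: an index of a component, and an angle in `[0, 1)`. -/
def circlePoints : Set (Fin 2 × ℝ) := {x | x.2 ∈ Ico (0 : ℝ) 1}

/-- A `V`-transverse multi-curve is a `V`-transverse link if it is an embedding; as it is
an immersion of a compact manifold, this means that it is injective on `S¹ ⊔ S¹`. -/
def IsLink (L : MultiCurve V) : Prop :=
  InjOn (fun x : Fin 2 × ℝ => L x.1 x.2) circlePoints

/-- `L` has a single double point, and the two branches of `L` have linearly independent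
tangent vectors there. -/
def HasSingleTransverseDoublePoint (L : MultiCurve V) : Prop :=
  ∃ x ∈ circlePoints, ∃ y ∈ circlePoints, x ≠ y ∧ L x.1 x.2 = L y.1 y.2 ∧
    LinearIndependent ℝ ![(L x.1).loop.chartVelocity (L x.1 x.2) x.2,
      (L y.1).loop.chartVelocity (L x.1 x.2) y.2] ∧
    ∀ x' ∈ circlePoints, ∀ y' ∈ circlePoints, x' ≠ y' → L x'.1 x'.2 = L y'.1 y'.2 →
      (x' = x ∧ y' = y) ∨ (x' = y ∧ y' = x)

/-- A `V`-transverse homotopy is a path `H` in the space of `V`-transverse multi-curves.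
It is generic if `H t` is an embedding for all but finitely many times `t`, and `H t` has a
single transverse double point at each of these times. -/
def IsGeneric {L L' : MultiCurve V} (H : Path L L') : Prop :=
  {t : I | ¬ IsLink (H t)}.Finite ∧
    ∀ t : I, ¬ IsLink (H t) → HasSingleTransverseDoublePoint (H t)

/-- The set `D₁₂` of double points between the two components during the homotopy `H`; a double
point `(t, a, b)` is recorded by its time and by its parameters on the two components. -/
def doublePoints {L L' : MultiCurve V} (H : Path L L') : Set (I × ℝ × ℝ) :=
  {x | x.2.1 ∈ Ico (0 : ℝ) 1 ∧ x.2.2 ∈ Ico (0 : ℝ) 1 ∧ H x.1 0 x.2.1 = H x.1 1 x.2.2}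

/-- `D₁₂` is finite for a generic homotopy. -/
theorem IsGeneric.finite_doublePoints {L L' : MultiCurve V} {H : Path L L'}
    (hH : IsGeneric H) : (doublePoints H).Finite := by
  have hbad : ∀ x ∈ doublePoints H, ¬ IsLink (H x.1) := by
    rintro ⟨t, a, b⟩ ⟨ha, hb, hab⟩ hL
    have := @hL ((0 : Fin 2), a) ha ((1 : Fin 2), b) hb hab
    simp at this
  refine Set.Finite.of_finite_image (f := Prod.fst) (hH.1.subset ?_) ?_
  · rintro _ ⟨x, hx, rfl⟩
    exact hbad x hx
  · rintro ⟨t, a, b⟩ hx ⟨t', a', b'⟩ hy htt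
    obtain rfl : t = t' := htt
    obtain ⟨u, -, v, -, -, -, -, huniq⟩ := hH.2 t (hbad _ hx)
    obtain ⟨ha, hb, hab⟩ := hx
    obtain ⟨ha', hb', hab'⟩ := hy
    have h1 := huniq ((0 : Fin 2), a) ha ((1 : Fin 2), b) hb (by simp) hab
    have h2 := huniq ((0 : Fin 2), a') ha' ((1 : Fin 2), b') hb' (by simp) hab'
    rcases h1 with ⟨h, h'⟩ | ⟨h, h'⟩ <;> rcases h2 with ⟨k, k'⟩ | ⟨k, k'⟩ <;> grind

section Sign

variable [IsManifold (𝓡 3) ∞ M]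

/-- Let `x = (t₀, a, b)` be a double point `p` of the components `A = H 0` and `B = H 1` with
independent tangent vectors `A'(a)`, `B'(b)`. For the times `t` in the filter `l` (which will be
the times just before or just after `t₀`), the nearby branches of `A` and `B` form a crossing when
they are projected, in the chart at `p`, along a direction `n` such that `(A'(a), B'(b), n)`
is a positive basis: there are nearby points of the branches with `A - B = c • n`.
The crossing is positive (right-handed) if `c > 0` and negative (left-handed) if `c < 0`.
This condition does not change if the roles of `A` and `B` are exchanged. -/
def HasCrossingSign (o : ManifoldOrientation M) {L L' : MultiCurve V} (H : Path L L')
    (x : I × ℝ × ℝ) (l : Filter I) (sgn : SignType) : Prop :=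
  let p : M := H x.1 0 x.2.1
  ∃ n : E3,
    (∃ f : Module.Basis (Fin 3) ℝ E3, f.orientation = o.inChart p ∧
      f 0 = (H x.1 0).loop.chartVelocity p x.2.1 ∧
      f 1 = (H x.1 1).loop.chartVelocity p x.2.2 ∧ f 2 = n) ∧
    ∀ U ∈ 𝓝 x.2, ∀ᶠ t in l, ∃ y ∈ U, ∃ c : ℝ,
      H t 0 y.1 ∈ (extChartAt (𝓡 3) p).source ∧ H t 1 y.2 ∈ (extChartAt (𝓡 3) p).source ∧
      extChartAt (𝓡 3) p (H t 0 y.1) - extChartAt (𝓡 3) p (H t 1 y.2) = c • n ∧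
      SignType.sign c = sgn

open Classical in
/-- The sign of the resolution of a double point: `1` if the homotopy passes from a negative to
a positive crossing, `-1` if it passes from a positive to a negative crossing (and `0` if the
strands merely touch, so that the crossing is the same before and after). -/
def resolutionSign (o : ManifoldOrientation M) {L L' : MultiCurve V} (H : Path L L')
    (x : I × ℝ × ℝ) : ℤ :=
  if HasCrossingSign o H x (𝓝[<] x.1) (-1) ∧ HasCrossingSign o H x (𝓝[>] x.1) 1 then 1
  else if HasCrossingSign o H x (𝓝[<] x.1) 1 ∧ HasCrossingSign o H x (𝓝[>] x.1) (-1) then -1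
  else 0

end Sign

/-- The space of `V`-transverse figure-8's: maps `S¹ ∨ S¹ → M` both of whose components are
`V`-transverse curves, with the `C^∞`-topology. The base point of `S¹ ∨ S¹` is the parameter `0`
on both circles. -/
def FigureEight (V : ∀ x : M, TangentSpace (𝓡 3) x) : Type _ :=
  {x : VLoop V × VLoop V // x.1 0 = x.2 0}

instance : TopologicalSpace (FigureEight V) :=
  inferInstanceAs (TopologicalSpace {x : VLoop V × VLoop V // x.1 0 = x.2 0})

/-- The figure-8 `A •_p B` with distinguished point `p = A(a) = B(b)`. -/
def figureEight (A B : VLoop V) (a b : ℝ) (h : A a = B b) : FigureEight V :=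
  ⟨(A.shift a, B.shift b), by
    show A (0 + a) = B (0 + b)
    rw [zero_add, zero_add, h]⟩

/-- The invariant `ν(H) = ∑ ε(tᵢ) [H_t(K₁) •_{pᵢ} H_t(K₂)]`, the sum over `D₁₂`, in the free abelian
group on the homotopy classes (path components) of `V`-transverse figure-8's. -/
def nu [IsManifold (𝓡 3) ∞ M] (o : ManifoldOrientation M) {L L' : MultiCurve V}
    (H : Path L L') : FreeAbelianGroup (ZerothHomotopy (FigureEight V)) :=
  ∑ᶠ x : doublePoints H, resolutionSign o H x.1 •
    FreeAbelianGroup.of (ZerothHomotopy.mk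
      (figureEight (H x.1.1 0) (H x.1.1 1) x.1.2.1 x.1.2.2 x.2.2.2))

/-- Two multi-curves are link-homotopic as `V`-transverse links if there is a generic
`V`-transverse homotopy between them during which no double points occur between distinct
components. -/
def LinkHomotopic (L L' : MultiCurve V) : Prop :=
  ∃ H : Path L L', IsGeneric H ∧ ∀ (t : I) (a b : ℝ), H t 0 a ≠ H t 1 b

/-- The components of `L` lie in the `V`-transverse homotopy classes (path components of the
space of `V`-transverse curves) `C 0` and `C 1`. -/
def HasComponentsIn (C : Fin 2 → ZerothHomotopy (VLoop V)) (L : MultiCurve V) : Prop :=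
  ∀ i, ZerothHomotopy.mk (L i) = C i

end Loops

end

/-! Close the given homotopy `H` from `L` to `L'` up to a self-homotopy of `L` by running a
link-homotopy `G` backwards from `L'` to `L`. The concatenation is generic, so its `ν` vanishes by
hypothesis. Since `G` has no double point between distinct components, every term of this `ν` comes
from `H`, and hence `ν(H) = 0` (`nu_trans_of_forall_ne`). What needs proof is that halving time
preserves each term. The figure-8's are literally the same, and the signs depend only on the
homotopy just before and just after the double point (`resolutionSign_trans_firstHalf`). This could
fail only at the final time of `H`, where the concatenation continues into the next homotopy; `L'`
being a link excludes double points there. -/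

/-- The map `t ↦ t / 2` of the unit interval to its first half. -/
noncomputable def unitInterval.firstHalf (t : I) : I :=
  ⟨t / 2, by have := t.2.1; have := t.2.2; constructor <;> linarith⟩

/-- The map `t ↦ (t + 1) / 2` of the unit interval to its second half. -/
noncomputable def unitInterval.secondHalf (t : I) : I :=
  ⟨(t + 1) / 2, by have := t.2.1; have := t.2.2; constructor <;> linarith⟩

open unitInterval

theorem unitInterval.coe_firstHalf (t : I) : (firstHalf t : ℝ) = t / 2 := rfl

theorem unitInterval.coe_secondHalf (t : I) : (secondHalf t : ℝ) = (t + 1) / 2 := rfl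

theorem unitInterval.strictMono_firstHalf : StrictMono firstHalf := fun s t h => by
  have h' : (s : ℝ) < t := h
  show (s : ℝ) / 2 < t / 2
  linarith

theorem unitInterval.isEmbedding_firstHalf : IsEmbedding firstHalf := by
  have hc : Continuous firstHalf := by unfold firstHalf; fun_prop
  exact (hc.isClosedEmbedding strictMono_firstHalf.injective).isEmbedding

theorem unitInterval.mem_range_firstHalf {s : I} : s ∈ range firstHalf ↔ (s : ℝ) ≤ 1 / 2 := by
  constructor
  · rintro ⟨t, rfl⟩
    have := t.2.2
    rw [coe_firstHalf]
    linarith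
  · intro h
    have := s.2.1
    refine ⟨⟨2 * s, by constructor <;> linarith⟩, Subtype.ext ?_⟩
    rw [coe_firstHalf]
    ring

theorem unitInterval.range_firstHalf_mem_nhds {t : I} (ht : t ≠ 1) :
    range firstHalf ∈ 𝓝 (firstHalf t) := by
  have ht' : (t : ℝ) < 1 := lt_of_le_of_ne t.2.2 fun h => ht (Subtype.ext h)
  have ho : IsOpen {s : I | (s : ℝ) < 1 / 2} :=
    isOpen_lt continuous_subtype_val continuous_const
  refine mem_of_superset (ho.mem_nhds ?_) fun s hs => mem_range_firstHalf.2 (le_of_lt hs)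
  show (t : ℝ) / 2 < 1 / 2
  linarith

/-- Transports the one-sided filters that define crossing signs. At `t = 1` it would fail: `𝓝[>] 1`
is trivial in `I`, whereas `𝓝[>]` at the midpoint is not. -/
theorem unitInterval.map_firstHalf_nhdsWithin {t : I} (ht : t ≠ 1) {s s' : Set I}
    (h : firstHalf ⁻¹' s' = s) : map firstHalf (𝓝[s] t) = 𝓝[s'] (firstHalf t) := by
  rw [isEmbedding_firstHalf.map_nhdsWithin_eq, ← h, image_preimage_eq_inter_range,
    nhdsWithin_inter_of_mem' (nhdsWithin_le_nhds (range_firstHalf_mem_nhds ht))]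

section Concatenation

variable {X : Type*} [TopologicalSpace X] {x y z : X}

theorem Path.trans_firstHalf (p : Path x y) (q : Path y z) (t : I) :
    p.trans q (firstHalf t) = p t := by
  have ht : (firstHalf t : ℝ) ≤ 1 / 2 := mem_range_firstHalf.1 ⟨t, rfl⟩
  rw [Path.trans_apply, dif_pos ht]
  congr 1
  ext
  simp only [coe_firstHalf]
  ring

theorem Path.trans_secondHalf (p : Path x y) (q : Path y z) (t : I) :
    p.trans q (secondHalf t) = q t := by
  -- Time reversal exchanges the two halves: `secondHalf t = σ (firstHalf (σ t))`.
  have h := Path.trans_firstHalf q.symm p.symm (σ t)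
  rw [← Path.trans_symm] at h
  replace h : p.trans q (σ (firstHalf (σ t))) = q (σ (σ t)) := h
  rw [unitInterval.symm_symm] at h
  rw [← h]
  congr 1
  ext
  simp only [coe_firstHalf, coe_secondHalf, coe_symm_eq]
  ring

theorem unitInterval.exists_eq_firstHalf_or_eq_secondHalf (s : I) :
    (∃ t, s = firstHalf t) ∨ ∃ t, s = secondHalf t := by
  rcases le_total (s : ℝ) (1 / 2) with h | h
  · obtain ⟨t, rfl⟩ := mem_range_firstHalf.2 h
    exact Or.inl ⟨t, rfl⟩
  · have := s.2.2
    refine Or.inr ⟨⟨2 * s - 1, by constructor <;> linarith⟩, Subtype.ext ?_⟩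
    rw [coe_secondHalf]
    ring

end Concatenation

section MultiCurves

variable {M : Type*} [TopologicalSpace M] [ChartedSpace E3 M] {V : ∀ x : M, TangentSpace (𝓡 3) x}
  {L L' L'' : MultiCurve V}

theorem IsGeneric.symm {H : Path L L'} (hH : IsGeneric H) : IsGeneric H.symm := by
  refine ⟨(hH.1.image σ).subset fun t ht => ⟨σ t, ht, symm_symm t⟩, fun t ht => hH.2 (σ t) ht⟩

/-- Genericity is a condition on each time separately plus finiteness, so the junction needs no
extra care. -/
theorem IsGeneric.trans {H : Path L L'} {G : Path L' L''} (hH : IsGeneric H) (hG : IsGeneric G) :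
    IsGeneric (H.trans G) := by
  refine ⟨((hH.1.image firstHalf).union (hG.1.image secondHalf)).subset ?_, ?_⟩
  · intro s hs
    rcases exists_eq_firstHalf_or_eq_secondHalf s with ⟨t, rfl⟩ | ⟨t, rfl⟩
    · rw [mem_ofPred_eq, Path.trans_firstHalf] at hs
      exact Or.inl ⟨t, hs, rfl⟩
    · rw [mem_ofPred_eq, Path.trans_secondHalf] at hs
      exact Or.inr ⟨t, hs, rfl⟩
  · intro s hs
    rcases exists_eq_firstHalf_or_eq_secondHalf s with ⟨t, rfl⟩ | ⟨t, rfl⟩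
    · rw [Path.trans_firstHalf] at hs ⊢
      exact hH.2 t hs
    · rw [Path.trans_secondHalf] at hs ⊢
      exact hG.2 t hs

theorem IsLink.apply_ne {L : MultiCurve V} (hL : IsLink L) {a b : ℝ} (ha : a ∈ Ico (0 : ℝ) 1)
    (hb : b ∈ Ico (0 : ℝ) 1) : L 0 a ≠ L 1 b := fun h => by
  simpa using @hL ((0 : Fin 2), a) ha ((1 : Fin 2), b) hb h

theorem ne_one_of_mem_doublePoints (hL' : IsLink L') {H : Path L L'} {x : I × ℝ × ℝ}
    (hx : x ∈ doublePoints H) : x.1 ≠ 1 := fun h => by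
  have h' := hx.2.2
  rw [h, H.target] at h'
  exact hL'.apply_ne hx.1 hx.2.1 h'

/-- The crossing signs are preserved by a reparametrization of time. -/
theorem hasCrossingSign_reparam_iff [IsManifold (𝓡 3) ∞ M] (o : ManifoldOrientation M)
    {H : Path L L'} {A B : MultiCurve V} {K : Path A B} {φ : I → I}
    (hφ : ∀ t, K (φ t) = H t) (x : I × ℝ × ℝ) {l l' : Filter I} (hl : map φ l = l')
    (sgn : SignType) :
    HasCrossingSign o K (φ x.1, x.2) l' sgn ↔ HasCrossingSign o H x l sgn := by
  -- The definition sees `K` only at the time `φ x.1` and along the filter `l'`, so no regularity of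
  -- `φ` is needed.
  subst hl
  simp only [HasCrossingSign, eventually_map, hφ]

variable [IsManifold (𝓡 3) ∞ M] (o : ManifoldOrientation M)

theorem resolutionSign_trans_firstHalf (H : Path L L') (G : Path L' L'') {x : I × ℝ × ℝ}
    (hx : x.1 ≠ 1) :
    resolutionSign o (H.trans G) (firstHalf x.1, x.2) = resolutionSign o H x := by
  have hlt : map firstHalf (𝓝[<] x.1) = 𝓝[<] (firstHalf x.1) :=
    map_firstHalf_nhdsWithin hx (by ext s; exact strictMono_firstHalf.lt_iff_lt)
  have hgt : map firstHalf (𝓝[>] x.1) = 𝓝[>] (firstHalf x.1) :=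
    map_firstHalf_nhdsWithin hx (by ext s; exact strictMono_firstHalf.lt_iff_lt)
  have hφ := Path.trans_firstHalf H G
  have hl (sgn) := hasCrossingSign_reparam_iff (φ := firstHalf) o hφ x hlt sgn
  have hr (sgn) := hasCrossingSign_reparam_iff (φ := firstHalf) o hφ x hgt sgn
  classical
  exact if_congr (and_congr (hl _) (hr _)) rfl
    (if_congr (and_congr (hl _) (hr _)) rfl rfl)

/-- A homotopy without double points between distinct components does not contribute to `ν`. -/
theorem nu_trans_of_forall_ne (hL' : IsLink L') (H : Path L L') (G : Path L' L'')
    (hG : ∀ (t : I) (a b : ℝ), G t 0 a ≠ G t 1 b) : nu o (H.trans G) = nu o H := by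
  have hφ := Path.trans_firstHalf H G
  let e : doublePoints H → doublePoints (H.trans G) := fun x =>
    ⟨(firstHalf x.1.1, x.1.2), x.2.1, x.2.2.1, by rw [hφ]; exact x.2.2.2⟩
  refine (finsum_eq_of_bijective e ⟨?_, ?_⟩ ?_).symm
  · rintro ⟨⟨t, a⟩, hx⟩ ⟨⟨s, b⟩, hy⟩ h
    have h' := Prod.ext_iff.1 (Subtype.ext_iff.1 h)
    exact Subtype.ext (Prod.ext (strictMono_firstHalf.injective h'.1) h'.2)
  · rintro ⟨⟨s, a, b⟩, ha, hb, hab⟩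
    rcases exists_eq_firstHalf_or_eq_secondHalf s with ⟨t, rfl⟩ | ⟨t, rfl⟩
    · exact ⟨⟨(t, a, b), ha, hb, by simpa only [hφ] using hab⟩, rfl⟩
    -- A double point in the second half would be one of `G` between distinct components.
    · simp only [Path.trans_secondHalf] at hab
      exact absurd hab (hG t a b)
  · intro x
    -- The proof of coincidence inside `figureEight` depends on the multi-curve, so equality is
    -- checked on the underlying pairs of curves.
    have hfig : figureEight (H x.1.1 0) (H x.1.1 1) x.1.2.1 x.1.2.2 x.2.2.2 =
        figureEight (H.trans G (e x).1.1 0) (H.trans G (e x).1.1 1) (e x).1.2.1 (e x).1.2.2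
          (e x).2.2.2 := by
      have h : H.trans G (e x).1.1 = H x.1.1 := hφ x.1.1
      refine Subtype.ext ?_
      simp only [figureEight, h]
      rfl
    rw [hfig]
    congr 1
    exact (resolutionSign_trans_firstHalf o H G (ne_one_of_mem_doublePoints hL' x.2)).symm

end MultiCurves

theorem mainTheorem9 {M : Type*} [TopologicalSpace M] [T2Space M] [CompactSpace M]
    [ConnectedSpace M] [ChartedSpace E3 M] [IsManifold (𝓡 3) ∞ M] (o : ManifoldOrientation M)
    (V : ∀ x : M, TangentSpace (𝓡 3) x)
    (hV : ContMDiff (𝓡 3) (𝓡 3).tangent ∞ (fun x => (⟨x, V x⟩ : TangentBundle (𝓡 3) M)))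
    (hV0 : ∀ x, V x ≠ 0)
    (C : Fin 2 → ZerothHomotopy (VLoop V))
    (hC : ∀ L : MultiCurve V, IsLink L → HasComponentsIn C L →
      ∀ H : Path L L, IsGeneric H → nu o H = 0) :
    ∀ L L' : MultiCurve V, IsLink L → IsLink L' → HasComponentsIn C L → HasComponentsIn C L' →
      LinkHomotopic L L' → ∀ H : Path L L', IsGeneric H → nu o H = 0 := by
  rintro L L' hL hL' hCL - ⟨G, hG, hG'⟩ H hH
  rw [← nu_trans_of_forall_ne o hL' H G.symm fun t => hG' (σ t)]
  exact hC L hL hCL _ (hH.trans hG.symm)
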